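/- Consider $n$ buyers with budgets $B_i\ge 0$, $m$ divisible goods, and valuations $v_{ij}:[0,\infty)\to\mathbb R$ that are concave, nondecreasing and satisfy $v_{ij}(0)=0$. Let $\mathrm{RMVUP}$ be the optimal revenue with variable unit prices, i.e. the supremum of $\sum_{i,j} b_{ij}$ over all $x_{ij}\ge 0$, $b_{ij}\ge 0$ with $\sum_i x_{ij}\le 1$ for all $j$, $\sum_j b_{ij}\le B_i$ for all $i$, and $b_{ij}\le v_{ij}(x_{ij})$ for all $i,j$. Consider the primal program $$\max_{u,\delta,x}\ \sum_{i}\big(B_i\ln u_i-\delta_i\big)\quad\text{s.t.}\quad u_i\le\sum_j v_{ij}(x_{ij})+\delta_i\ \ \forall i,\qquad \sum_i x_{ij}\le 1\ \ \forall j,\qquad u_i,\delta_i,x_{ij}\ge 0,$$ and the dual program $$\min_{\alpha,p}\ \sum_i\Big(B_i\ln\frac{B_i}{\alpha_i}-B_i\Big)+\sum_j p_j+\sum_{i,j}\sup_{t\ge 0}\big(\alpha_i v_{ij}(t)-p_j t\big)\quad\text{s.t.}\quad 0<\alpha_i\le 1\ \ \forall i,\qquad p_j\ge 0\ \ \forall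 j,$$ with the conventions $\ln 0=-\infty$ and $0\ln 0=0$. Solutions of either program are understood to have a finite objective value. Let $(x,u,\delta)$ be an optimal solution of the primal program and $(\alpha,p)$ an optimal solution of the dual program. Then: 1. (Individual rationality) $p_j x_{ij}\le v_{ij}(x_{ij})$ for all $i,j$. 2. (Budget feasibility) $\sum_j p_j x_{ij}\le B_i$ for all $i$. 3. (Revenue) Suppose that every $v_{ij}$ has a finite right derivative $v_{ij}'(0)$ at $0$ and is differentiable at $1$, with $v'_{ij}(1)>0$ unless $v_{ij}\equiv 0$. Put $r:=\max_{i,j} v'_{ij}(0)/v'_{ij}(1)$, where valuations $v_{ij}\equiv 0$ contribute the ratio $0$ (and $r:=0$ if there are no buyers or no goods). Then $$\sum_{i,j}p_j x_{ij}\ \ge\ \frac{1}{\rho(\rho+1)}\cdot \mathrm{RMVUP}$$ holds for $\rho:=r$. If moreover every $v_{ij}$ is differentiable on $(0,1)$ and $t\mapsto t\,v'_{ij}(t)$ is nondecreasing on $(0,1]$, then the same inequality holds for $\rho:=1+\ln r$ and also for $\rho:=\log_2(1+r)$. (If all valuations vanish identically or there are no buyers or no goods, then $r=0$ and $\mathrm{RMVUP}=0$;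 in that case $1/(\rho(\rho+1))$ is read as $0$ when $\rho=0$, $\ln r$ is read as $0$, and the inequality is trivial.) -/

import Mathlib

/-!
Markets with `n` buyers with budgets `B i`, `m` divisible goods, and valuations `v i j`, where
`v i j t` is the value that buyer `i` derives from the quantity `t ≥ 0` of good `j`.
An allocation is a matrix `x`, with `x i j` the quantity of good `j` given to buyer `i`.
-/

noncomputable section

namespace ConcaveMarket

variable {n m : ℕ}

/-- A valuation: a concave, nondecreasing function on `[0, ∞)` that vanishes at `0`. -/
structure IsValuation (f : ℝ → ℝ) : Prop where
  zero : f 0 = 0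
  mono : MonotoneOn f (Set.Ici 0)
  concave : ConcaveOn ℝ (Set.Ici 0) f

/-! ### The revenue benchmark with variable unit prices -/

/-- Feasibility of an allocation `x` with payments `b` in the program RMVUP. -/
structure RMVUPFeasible (B : Fin n → ℝ) (v : Fin n → Fin m → ℝ → ℝ)
    (x b : Fin n → Fin m → ℝ) : Prop where
  supply : ∀ j, ∑ i, x i j ≤ 1
  budget : ∀ i, ∑ j, b i j ≤ B i
  rational : ∀ i j, b i j ≤ v i j (x i j)
  x_nonneg : ∀ i j, 0 ≤ x i j
  b_nonneg : ∀ i j, 0 ≤ b i j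

/-- The optimal revenue with variable unit prices. For nonnegative budgets this is the supremum of
a nonempty set of reals that is bounded above by the sum of the budgets. -/
def RMVUP (B : Fin n → ℝ) (v : Fin n → Fin m → ℝ → ℝ) : ℝ :=
  sSup {R | ∃ x b, RMVUPFeasible B v x b ∧ R = ∑ i, ∑ j, b i j}

/-! ### The primal program -/

/-- The constraints of the primal program. The field `u_pos` says that the objective is not `-∞`
(with the usual conventions `ln 0 = -∞` and `0 * ln 0 = 0`). -/
structure PrimalFeasible (B : Fin n → ℝ) (v : Fin n → Fin m → ℝ → ℝ)
    (x : Fin n → Fin m → ℝ) (u δ : Fin n → ℝ) : Prop where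
  utility : ∀ i, u i ≤ ∑ j, v i j (x i j) + δ i
  supply : ∀ j, ∑ i, x i j ≤ 1
  u_nonneg : ∀ i, 0 ≤ u i
  δ_nonneg : ∀ i, 0 ≤ δ i
  x_nonneg : ∀ i j, 0 ≤ x i j
  u_pos : ∀ i, 0 < B i → 0 < u i

/-- The objective of the primal program. -/
def primalObj (B u δ : Fin n → ℝ) : ℝ :=
  ∑ i, (B i * Real.log (u i) - δ i)

/-- `(x, u, δ)` is an optimal solution of the primal program. -/
structure IsPrimalSolution (B : Fin n → ℝ) (v : Fin n → Fin m → ℝ → ℝ)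
    (x : Fin n → Fin m → ℝ) (u δ : Fin n → ℝ) : Prop where
  feasible : PrimalFeasible B v x u δ
  optimal : ∀ x' u' δ', PrimalFeasible B v x' u' δ' → primalObj B u' δ' ≤ primalObj B u δ

/-! ### The dual program -/

/-- The constraints of the dual program. The field `bdd` says that the suprema in the objective
are finite, that is, that the objective is not `+∞`. -/
structure DualFeasible (v : Fin n → Fin m → ℝ → ℝ)
    (α : Fin n → ℝ) (p : Fin m → ℝ) : Prop where
  α_pos : ∀ i, 0 < α i
  α_le_one : ∀ i, α i ≤ 1
  p_nonneg : ∀ j, 0 ≤ p j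
  bdd : ∀ i j, BddAbove ((fun t : ℝ => α i * v i j t - p j * t) '' Set.Ici 0)

/-- The objective of the dual program (for `B i = 0` the term `B i * ln (B i / α i)` is `0`). -/
def dualObj (B : Fin n → ℝ) (v : Fin n → Fin m → ℝ → ℝ)
    (α : Fin n → ℝ) (p : Fin m → ℝ) : ℝ :=
  ∑ i, (B i * Real.log (B i / α i) - B i) + ∑ j, p j
    + ∑ i, ∑ j, sSup ((fun t : ℝ => α i * v i j t - p j * t) '' Set.Ici 0)

/-- `(α, p)` is an optimal solution of the dual program. -/
structure IsDualSolution (B : Fin n → ℝ) (v : Fin n → Fin m → ℝ → ℝ)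
    (α : Fin n → ℝ) (p : Fin m → ℝ) : Prop where
  feasible : DualFeasible v α p
  optimal : ∀ α' p', DualFeasible v α' p' → dualObj B v α p ≤ dualObj B v α' p'

/-! ### Slopes of the valuations -/

/-- A valuation has a finite slope at `0` (from the right) and is differentiable at `1`, with
positive derivative there unless it is the zero valuation. -/
structure RegularSlopes (f : ℝ → ℝ) : Prop where
  diff_zero : DifferentiableWithinAt ℝ f (Set.Ici 0) 0
  diff_one : DifferentiableAt ℝ f 1
  pos_or_zero : 0 < deriv f 1 ∨ ∀ t, 0 ≤ t → f t = 0

/-- The maximum over all pairs `(i, j)` of the ratio of the slope of `v i j` at `0` to its slope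
at `1`. (A zero valuation contributes `0 / 0 = 0`; all other ratios are at least `1`.) -/
def slopeRatio (v : Fin n → Fin m → ℝ → ℝ) : ℝ :=
  ⨆ ij : Fin n × Fin m,
    derivWithin (v ij.1 ij.2) (Set.Ici 0) 0 / deriv (v ij.1 ij.2) 1

end ConcaveMarket

end

/-!
The primal program maximizes a concave function under concave constraints and has a Slater point,
so multipliers `(α', p')` exist for which the Lagrangian never exceeds the primal optimum. They may
fail to be dual feasible, since `α' i = 0` is possible for a buyer without budget. But the
Lagrangian is affine in the multipliers, so at the midpoint of `(α', p')` and the dual solution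
`(α, p)`, which is feasible, the dual objective is at most the average of the two optima; as it is
also at least the dual optimum, there is no duality gap.

Complementary slackness then turns the pair of solutions into a market equilibrium: buyer `i`
demands `x i j` at the price `p j` when values are scaled by `α i`, every good with a positive
price is sold out, and a buyer with `α i < 1` spends the whole scaled utility `B i`. If payments
recover a `1 / ρ` fraction of the scaled values, then buyer `i` pays in any solution of RMVUP at
most `ρ` times the equilibrium payment plus the equilibrium price of the goods received, so RMVUP
is at most `ρ + 1` times the equilibrium revenue. By concavity `ρ = r` is such a factor, and
`ρ = 1 + log r` is one when `t * v'(t)` is nondecreasing.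
-/

/-! ### Lagrange multipliers for concave programs -/

section LagrangeMultipliers

variable {E : Type*} [AddCommMonoid E] [Module ℝ E] {S : Set E}

theorem concaveOn_finset_sum {ι : Type*} (s : Finset ι) {f : ι → E → ℝ} (hS : Convex ℝ S)
    (hf : ∀ i ∈ s, ConcaveOn ℝ S (f i)) : ConcaveOn ℝ S fun y => ∑ i ∈ s, f i y := by
  classical
  induction s using Finset.induction_on with
  | empty => simpa using concaveOn_const (0 : ℝ) hS
  | insert i s his ih =>
    simp only [Finset.sum_insert his]
    exact (hf i (Finset.mem_insert_self i s)).add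
      (ih fun k hk => hf k (Finset.mem_insert_of_mem hk))

variable {F : E → ℝ} {M : ℝ}

theorem ratio_le_ratio_of_constrained_le {h : E → ℝ} (hF : ConcaveOn ℝ S F)
    (hh : ConcaveOn ℝ S h) (hM : ∀ y ∈ S, 0 ≤ h y → F y ≤ M) {y z : E} (hy : y ∈ S)
    (hhy : h y < 0) (hz : z ∈ S) (hhz : 0 < h z) :
    (F y - M) / -h y ≤ (M - F z) / h z := by
  have hpos : 0 < h z - h y := by linarith
  -- the weights with which the chord from `(y, h y)` to `(z, h z)` crosses height `0`
  set a := h z / (h z - h y) with ha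
  set b := -h y / (h z - h y) with hb
  have ha0 : 0 ≤ a := div_nonneg hhz.le hpos.le
  have hb0 : 0 ≤ b := div_nonneg (neg_nonneg.2 hhy.le) hpos.le
  have hab : a + b = 1 := by rw [ha, hb]; field_simp; ring
  have hcross : a * h y + b * h z = 0 := by rw [ha, hb]; field_simp; ring
  have hh_mix := hh.2 hy hz ha0 hb0 hab
  have hF_mix := hF.2 hy hz ha0 hb0 hab
  simp only [smul_eq_mul] at hh_mix hF_mix
  have hle : a * F y + b * F z ≤ M :=
    hF_mix.trans (hM _ (hF.1 hy hz ha0 hb0 hab) (hcross.symm.le.trans hh_mix))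
  rw [ha, hb, div_mul_eq_mul_div, div_mul_eq_mul_div, ← add_div, div_le_iff₀ hpos] at hle
  rw [div_le_div_iff₀ (neg_pos.2 hhy) hhz]
  linarith

theorem exists_lagrange_multiplier {h : E → ℝ} (hF : ConcaveOn ℝ S F) (hh : ConcaveOn ℝ S h)
    (slater : ∃ z ∈ S, 0 < h z) (hM : ∀ y ∈ S, 0 ≤ h y → F y ≤ M) :
    ∃ p : ℝ, 0 ≤ p ∧ ∀ y ∈ S, F y + p * h y ≤ M := by
  obtain ⟨z₀, hz₀, hhz₀⟩ := slater
  obtain ⟨p, hp_lower, hp_upper⟩ := exists_between_of_forall_le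
    (s := insert 0 ((fun y => (F y - M) / -h y) '' {y ∈ S | h y < 0}))
    (t := (fun z => (M - F z) / h z) '' {z ∈ S | 0 < h z})
    (Set.insert_nonempty _ _) ⟨_, z₀, ⟨hz₀, hhz₀⟩, rfl⟩ (by
      rintro _ (rfl | ⟨y, ⟨hy, hhy⟩, rfl⟩) _ ⟨z, ⟨hz, hhz⟩, rfl⟩
      · exact div_nonneg (sub_nonneg.2 (hM z hz hhz.le)) hhz.le
      · exact ratio_le_ratio_of_constrained_le hF hh hM hy hhy hz hhz)
  refine ⟨p, hp_lower (Set.mem_insert _ _), fun y hy => ?_⟩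
  rcases lt_trichotomy (h y) 0 with hneg | hzero | hpos
  · have := hp_lower (Set.mem_insert_of_mem _ ⟨y, ⟨hy, hneg⟩, rfl⟩)
    rw [div_le_iff₀ (neg_pos.2 hneg)] at this
    linarith
  · simpa [hzero] using hM y hy hzero.ge
  · have := hp_upper ⟨y, ⟨hy, hpos⟩, rfl⟩
    rw [le_div_iff₀ hpos] at this
    linarith

theorem exists_lagrange_multipliers {ι : Type*} (s : Finset ι) {h : ι → E → ℝ}
    (hF : ConcaveOn ℝ S F) (hh : ∀ i ∈ s, ConcaveOn ℝ S (h i))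
    (slater : ∃ z ∈ S, ∀ i ∈ s, 0 < h i z) (hM : ∀ y ∈ S, (∀ i ∈ s, 0 ≤ h i y) → F y ≤ M) :
    ∃ p : ι → ℝ, (∀ i, 0 ≤ p i) ∧ ∀ y ∈ S, F y + ∑ i ∈ s, p i * h i y ≤ M := by
  classical
  induction s using Finset.induction_on generalizing F with
  | empty => exact ⟨0, fun _ => le_rfl, fun y hy => by simpa using hM y hy (by simp)⟩
  | insert k s hk ih =>
    simp only [Finset.forall_mem_insert] at hh slater hM
    obtain ⟨z, hz, hzk, hzs⟩ := slater
    have hS' : Convex ℝ {y ∈ S | ∀ i ∈ s, 0 ≤ h i y} := fun y hy z hz a b ha hb hab =>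
      ⟨hF.1 hy.1 hz.1 ha hb hab, fun i hi =>
        ((hh.2 i hi).convex_ge 0 ⟨hy.1, hy.2 i hi⟩ ⟨hz.1, hz.2 i hi⟩ ha hb hab).2⟩
    obtain ⟨q, hq0, hq⟩ := exists_lagrange_multiplier (hF.subset (Set.sep_subset _ _) hS')
      (hh.1.subset (Set.sep_subset _ _) hS') ⟨z, ⟨hz, fun i hi => (hzs i hi).le⟩, hzk⟩
      fun y hy hky => hM y hy.1 ⟨hky, hy.2⟩
    obtain ⟨p, hp0, hp⟩ := ih (hF.add (hh.1.smul hq0)) hh.2 ⟨z, hz, hzs⟩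
      fun y hy hys => hq y ⟨hy, hys⟩
    refine ⟨Function.update p k q, fun i => ?_, fun y hy => ?_⟩
    · rcases eq_or_ne i k with rfl | hik
      · simpa using hq0
      · simpa [hik] using hp0 i
    · have hrest : ∑ i ∈ s, Function.update p k q i * h i y = ∑ i ∈ s, p i * h i y :=
        Finset.sum_congr rfl fun i hi => by
          rw [Function.update_of_ne (ne_of_mem_of_not_mem hi hk)]
      rw [Finset.sum_insert hk, Function.update_self, hrest, ← add_assoc]
      exact hp y hy

end LagrangeMultipliers

/-! ### Suprema and logarithms -/

theorem nonpos_of_forall_nonneg_mul_le {c K : ℝ} (h : ∀ t, 0 ≤ t → c * t ≤ K) : c ≤ 0 := by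
  by_contra! hc
  have hK : 0 ≤ K := by simpa using h 0 le_rfl
  have := h ((K + 1) / c) (by positivity)
  rw [mul_div_cancel₀ _ hc.ne'] at this
  linarith

section SumSup

variable {ι : Type*} [Fintype ι] {A : ι → Set ℝ} {K : ℝ}

theorem bddAbove_of_forall_sum_le (hA : ∀ i, (A i).Nonempty)
    (h : ∀ a : ι → ℝ, (∀ i, a i ∈ A i) → ∑ i, a i ≤ K) (i : ι) : BddAbove (A i) := by
  classical
  choose a ha using hA
  refine ⟨K - ∑ k ∈ Finset.univ \ {i}, a k, fun t ht => ?_⟩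
  have hmem : ∀ k, Function.update a i t k ∈ A k :=
    (Function.forall_update_iff a fun k s => s ∈ A k).2 ⟨ht, fun k _ => ha k⟩
  have := h _ hmem
  rw [Finset.sum_update_of_mem (Finset.mem_univ i)] at this
  linarith

theorem sum_sSup_le_of_forall_sum_le (hA : ∀ i, (A i).Nonempty)
    (h : ∀ a : ι → ℝ, (∀ i, a i ∈ A i) → ∑ i, a i ≤ K) : ∑ i, sSup (A i) ≤ K := by
  have hclosed : IsClosed {a : ι → ℝ | ∑ i, a i ≤ K} :=
    isClosed_le (by fun_prop) continuous_const
  have hsub : Set.univ.pi A ⊆ {a : ι → ℝ | ∑ i, a i ≤ K} := fun a ha => h a fun i => ha i trivial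
  refine closure_minimal hsub hclosed (?_ : (fun i => sSup (A i)) ∈ closure (Set.univ.pi A))
  rw [closure_pi_set]
  exact fun i _ => csSup_mem_closure (hA i) (bddAbove_of_forall_sum_le hA h i)

end SumSup

section LogConjugate

variable {B a u : ℝ}

theorem mul_log_sub_mul_lt (hB : 0 ≤ B) (ha : 0 < a) (hu : 0 ≤ u) (hBu : 0 < B → 0 < u)
    (hne : a * u ≠ B) : B * Real.log u - a * u < B * Real.log (B / a) - B := by
  rcases hB.eq_or_lt with rfl | hB
  · simpa using lt_of_le_of_ne (mul_nonneg ha.le hu) hne.symm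
  · have hu := hBu hB
    have hlog := Real.log_lt_sub_one_of_pos (div_pos (mul_pos ha hu) hB)
      (by rwa [Ne, div_eq_one_iff_eq hB.ne'])
    have hsplit : Real.log (a * u / B) = Real.log u - Real.log (B / a) := by
      rw [← Real.log_div hu.ne' (div_pos hB ha).ne', div_div_eq_mul_div, mul_comm]
    have := mul_lt_mul_of_pos_left hlog hB
    rw [hsplit, mul_sub, mul_sub, mul_div_cancel₀ _ hB.ne'] at this
    linarith

theorem mul_log_sub_mul_le (hB : 0 ≤ B) (ha : 0 < a) (hu : 0 ≤ u) (hBu : 0 < B → 0 < u) :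
    B * Real.log u - a * u ≤ B * Real.log (B / a) - B := by
  rcases eq_or_ne (a * u) B with rfl | hne
  · rw [mul_div_cancel_left₀ _ ha.ne']
  · exact (mul_log_sub_mul_lt hB ha hu hBu hne).le

end LogConjugate

namespace ConcaveMarket

variable {n m : ℕ} {B : Fin n → ℝ} {v : Fin n → Fin m → ℝ → ℝ} {x : Fin n → Fin m → ℝ}
  {u δ α : Fin n → ℝ} {p : Fin m → ℝ}

theorem IsValuation.nonneg {f : ℝ → ℝ} (hf : IsValuation f) {t : ℝ} (ht : 0 ≤ t) : 0 ≤ f t :=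
  hf.zero.symm.le.trans (hf.mono Set.self_mem_Ici ht ht)

/-! ### The Lagrangian of the primal program -/

/-- The implicit constraints of the primal program: the set of all triples `(x, u, δ)` that satisfy
the constraints of `PrimalFeasible` other than `utility` and `supply`, to which the multipliers
`α` and `p` belong. -/
def primalDomain (m : ℕ) (B : Fin n → ℝ) :
    Set ((Fin n → Fin m → ℝ) × (Fin n → ℝ) × (Fin n → ℝ)) :=
  {y | (∀ i j, 0 ≤ y.1 i j) ∧ (∀ i, 0 ≤ y.2.1 i) ∧ (∀ i, 0 ≤ y.2.2 i) ∧ ∀ i, 0 < B i → 0 < y.2.1 i}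

/-- The Lagrangian of the primal program, with multipliers `α` for the utility constraints and `p`
for the supply constraints. -/
noncomputable def lagrangian (B : Fin n → ℝ) (v : Fin n → Fin m → ℝ → ℝ) (α : Fin n → ℝ)
    (p : Fin m → ℝ) (x : Fin n → Fin m → ℝ) (u δ : Fin n → ℝ) : ℝ :=
  primalObj B u δ + ∑ i, α i * (∑ j, v i j (x i j) + δ i - u i) + ∑ j, p j * (1 - ∑ i, x i j)

theorem PrimalFeasible.mem_primalDomain (h : PrimalFeasible B v x u δ) :
    (x, u, δ) ∈ primalDomain m B :=
  ⟨h.x_nonneg, h.u_nonneg, h.δ_nonneg, h.u_pos⟩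

theorem lagrangian_eq_separable (B : Fin n → ℝ) (v : Fin n → Fin m → ℝ → ℝ) (α : Fin n → ℝ)
    (p : Fin m → ℝ) (x : Fin n → Fin m → ℝ) (u δ : Fin n → ℝ) :
    lagrangian B v α p x u δ =
      ∑ i, (B i * Real.log (u i) - α i * u i) - ∑ i, (1 - α i) * δ i + ∑ j, p j
        + ∑ i, ∑ j, (α i * v i j (x i j) - p j * x i j) := by
  have hcomm : ∑ j, p j * ∑ i, x i j = ∑ i, ∑ j, p j * x i j := by
    simp only [Finset.mul_sum]
    exact Finset.sum_comm
  simp only [lagrangian, primalObj, mul_add, mul_sub, sub_mul, mul_one, one_mul,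
    Finset.sum_add_distrib, Finset.sum_sub_distrib, hcomm]
  simp only [Finset.mul_sum]
  ring

theorem lagrangian_midpoint (B : Fin n → ℝ) (v : Fin n → Fin m → ℝ → ℝ) (α α' : Fin n → ℝ)
    (p p' : Fin m → ℝ) (x : Fin n → Fin m → ℝ) (u δ : Fin n → ℝ) :
    lagrangian B v (fun i => (α i + α' i) / 2) (fun j => (p j + p' j) / 2) x u δ =
      (lagrangian B v α p x u δ + lagrangian B v α' p' x u δ) / 2 := by
  simp only [lagrangian, div_mul_eq_mul_div, add_mul, ← Finset.sum_div, Finset.sum_add_distrib]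
  ring

theorem convex_primalDomain : Convex ℝ (primalDomain m B) := fun _ hy _ hz _ _ ha hb hab =>
  ⟨fun i j => convex_Ici (0 : ℝ) (hy.1 i j) (hz.1 i j) ha hb hab,
    fun i => convex_Ici (0 : ℝ) (hy.2.1 i) (hz.2.1 i) ha hb hab,
    fun i => convex_Ici (0 : ℝ) (hy.2.2.1 i) (hz.2.2.1 i) ha hb hab,
    fun i hi => convex_Ioi (0 : ℝ) (hy.2.2.2 i hi) (hz.2.2.2 i hi) ha hb hab⟩

theorem concaveOn_primalObj (hB : ∀ i, 0 ≤ B i) :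
    ConcaveOn ℝ (primalDomain m B) fun y => primalObj B y.2.1 y.2.2 := by
  refine concaveOn_finset_sum _ convex_primalDomain fun i _ => ?_
  refine ConcaveOn.sub ?_ ⟨convex_primalDomain, fun y _ z _ a b _ _ _ => by simp⟩
  rcases (hB i).eq_or_lt with hi | hi
  · simpa [← hi] using concaveOn_const (0 : ℝ) convex_primalDomain
  · exact ((strictConcaveOn_log_Ioi.concaveOn.comp_linearMap
      (.proj i ∘ₗ .fst ℝ _ _ ∘ₗ .snd ℝ _ _)).subset (fun y hy => hy.2.2.2 i hi)
        convex_primalDomain).smul (hB i)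

theorem concaveOn_utility_slack (hv : ∀ i j, ConcaveOn ℝ (Set.Ici 0) (v i j)) (i : Fin n) :
    ConcaveOn ℝ (primalDomain m B) fun y => ∑ j, v i j (y.1 i j) + y.2.2 i - y.2.1 i := by
  refine ConcaveOn.sub (ConcaveOn.add ?_ ⟨convex_primalDomain, fun y _ z _ a b _ _ _ => by simp⟩)
    ⟨convex_primalDomain, fun y _ z _ a b _ _ _ => by simp⟩
  exact concaveOn_finset_sum _ convex_primalDomain fun j _ =>
    ((hv i j).comp_linearMap (.proj j ∘ₗ .proj i ∘ₗ .fst ℝ _ _)).subset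
      (fun y hy => hy.1 i j) convex_primalDomain

theorem concaveOn_supply_slack (j : Fin m) :
    ConcaveOn ℝ (primalDomain m B) fun y => 1 - ∑ i, y.1 i j :=
  (concaveOn_const 1 convex_primalDomain).sub
    ⟨convex_primalDomain, fun y _ z _ a b _ _ _ => by
      simp [Finset.sum_add_distrib, Finset.mul_sum]⟩

theorem IsPrimalSolution.exists_multipliers (hB : ∀ i, 0 ≤ B i)
    (hv : ∀ i j, IsValuation (v i j)) (h : IsPrimalSolution B v x u δ) :
    ∃ (α : Fin n → ℝ) (p : Fin m → ℝ), (∀ i, 0 ≤ α i) ∧ (∀ j, 0 ≤ p j) ∧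
      ∀ y ∈ primalDomain m B, lagrangian B v α p y.1 y.2.1 y.2.2 ≤ primalObj B u δ := by
  let slack : Fin n ⊕ Fin m → (Fin n → Fin m → ℝ) × (Fin n → ℝ) × (Fin n → ℝ) → ℝ :=
    Sum.elim (fun i y => ∑ j, v i j (y.1 i j) + y.2.2 i - y.2.1 i) fun j y => 1 - ∑ i, y.1 i j
  have hslack : ∀ k, ConcaveOn ℝ (primalDomain m B) (slack k) :=
    Sum.rec (concaveOn_utility_slack fun i j => (hv i j).concave) concaveOn_supply_slack
  obtain ⟨q, hq0, hq⟩ := exists_lagrange_multipliers Finset.univ (concaveOn_primalObj hB)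
    (fun k _ => hslack k)
    ⟨(0, 1, 2), by simp [primalDomain], by simp [slack, (hv _ _).zero]⟩
    fun y ⟨hx, hu, hδ, hu_pos⟩ hfeas => h.optimal y.1 y.2.1 y.2.2
      { utility := fun i => sub_nonneg.1 (hfeas (.inl i) (Finset.mem_univ _))
        supply := fun j => sub_nonneg.1 (hfeas (.inr j) (Finset.mem_univ _))
        u_nonneg := hu
        δ_nonneg := hδ
        x_nonneg := hx
        u_pos := hu_pos }
  refine ⟨q ∘ .inl, q ∘ .inr, fun i => hq0 _, fun j => hq0 _, fun y hy => ?_⟩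
  simpa [lagrangian, slack, add_assoc] using hq y hy

/-! ### Strong duality -/

section PrimalSlack

variable (h : PrimalFeasible B v x u δ) (hα : ∀ i, 0 ≤ α i) (hp : ∀ j, 0 ≤ p j)

include h hα in
theorem PrimalFeasible.utility_term_nonneg (i : Fin n) :
    0 ≤ α i * (∑ j, v i j (x i j) + δ i - u i) :=
  mul_nonneg (hα i) (sub_nonneg.2 (h.utility i))

include h hp in
theorem PrimalFeasible.supply_term_nonneg (j : Fin m) : 0 ≤ p j * (1 - ∑ i, x i j) :=
  mul_nonneg (hp j) (sub_nonneg.2 (h.supply j))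

include h hα hp

theorem PrimalFeasible.primalObj_le_lagrangian : primalObj B u δ ≤ lagrangian B v α p x u δ := by
  have hutility := Finset.sum_nonneg fun i (_ : _ ∈ Finset.univ) => h.utility_term_nonneg hα i
  have hsupply := Finset.sum_nonneg fun j (_ : _ ∈ Finset.univ) => h.supply_term_nonneg hp j
  rw [lagrangian]
  linarith

theorem PrimalFeasible.complementary_slackness
    (hle : lagrangian B v α p x u δ ≤ primalObj B u δ) :
    (∀ i, α i * (∑ j, v i j (x i j) + δ i - u i) = 0) ∧ ∀ j, p j * (1 - ∑ i, x i j) = 0 := by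
  have hutility := Finset.sum_nonneg fun i (_ : _ ∈ Finset.univ) => h.utility_term_nonneg hα i
  have hsupply := Finset.sum_nonneg fun j (_ : _ ∈ Finset.univ) => h.supply_term_nonneg hp j
  rw [lagrangian] at hle
  exact ⟨congrFun ((Fintype.sum_eq_zero_iff_of_nonneg (h.utility_term_nonneg hα)).1 (by linarith)),
    congrFun ((Fintype.sum_eq_zero_iff_of_nonneg (h.supply_term_nonneg hp)).1 (by linarith))⟩

end PrimalSlack

section LagrangianBound

variable {K : ℝ} (hB : ∀ i, 0 ≤ B i) (hα : ∀ i, 0 < α i)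
  (hK : ∀ y ∈ primalDomain m B, lagrangian B v α p y.1 y.2.1 y.2.2 ≤ K)

include hB hα hK

/-- Takes `u i = B i / α i`, which maximizes `B i * log (u i) - α i * u i`. -/
theorem separated_lagrangian_le (hx : ∀ i j, 0 ≤ x i j) (hδ : ∀ i, 0 ≤ δ i) :
    ∑ i, (B i * Real.log (B i / α i) - B i) - ∑ i, (1 - α i) * δ i + ∑ j, p j
      + ∑ i, ∑ j, (α i * v i j (x i j) - p j * x i j) ≤ K := by
  have := hK (x, fun i => B i / α i, δ)
    ⟨hx, fun i => div_nonneg (hB i) (hα i).le, hδ, fun i hi => div_pos hi (hα i)⟩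
  rw [lagrangian_eq_separable] at this
  simpa only [mul_div_cancel₀ _ (hα _).ne'] using this

theorem multiplier_le_one_of_lagrangian_le (i : Fin n) : α i ≤ 1 := by
  refine sub_nonpos.1 (nonpos_of_forall_nonneg_mul_le (K := K -
    (∑ i, (B i * Real.log (B i / α i) - B i) + ∑ j, p j + ∑ i, ∑ j, α i * v i j 0)) fun t ht => ?_)
  have := separated_lagrangian_le hB hα hK (x := 0) (δ := Pi.single i t) (fun _ _ => le_rfl)
    (Pi.single_nonneg.2 ht : 0 ≤ (Pi.single i t : Fin n → ℝ))
  simp only [Pi.single_apply, mul_ite, mul_zero, Finset.sum_ite_eq', Finset.mem_univ, if_true,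
    Pi.zero_apply, sub_zero] at this
  linarith

theorem sum_surplus_le_of_lagrangian_le (a : Fin n × Fin m → ℝ)
    (ha : ∀ k, a k ∈ (fun t : ℝ => α k.1 * v k.1 k.2 t - p k.2 * t) '' Set.Ici 0) :
    ∑ k, a k ≤ K - (∑ i, (B i * Real.log (B i / α i) - B i) + ∑ j, p j) := by
  choose t ht hta using ha
  have := separated_lagrangian_le hB hα hK (x := fun i j => t (i, j)) (δ := 0)
    (fun i j => ht (i, j)) fun _ => le_rfl
  simp only [Pi.zero_apply, mul_zero, Finset.sum_const_zero, sub_zero] at this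
  simp only [← hta, Fintype.sum_prod_type]
  linarith

theorem dualFeasible_of_lagrangian_le (hp : ∀ j, 0 ≤ p j) : DualFeasible v α p where
  α_pos := hα
  α_le_one := multiplier_le_one_of_lagrangian_le hB hα hK
  p_nonneg := hp
  bdd i j := bddAbove_of_forall_sum_le (fun _ => Set.nonempty_Ici.image _)
    (sum_surplus_le_of_lagrangian_le hB hα hK) (i, j)

theorem dualObj_le_of_lagrangian_le : dualObj B v α p ≤ K := by
  have := sum_sSup_le_of_forall_sum_le (fun _ => Set.nonempty_Ici.image _)
    (sum_surplus_le_of_lagrangian_le hB hα hK)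
  rw [Fintype.sum_prod_type] at this
  rw [dualObj]
  linarith

end LagrangianBound

section DualSlack

variable (hd : DualFeasible v α p)

include hd

theorem DualFeasible.surplus_le_sSup (i : Fin n) (j : Fin m) {t : ℝ} (ht : 0 ≤ t) :
    α i * v i j t - p j * t ≤ sSup ((fun t : ℝ => α i * v i j t - p j * t) '' Set.Ici 0) :=
  le_csSup (hd.bdd i j) ⟨t, ht, rfl⟩

variable (hB : ∀ i, 0 ≤ B i) (hy : (x, u, δ) ∈ primalDomain m B)

include hy

theorem DualFeasible.saving_term_nonneg (i : Fin n) : 0 ≤ (1 - α i) * δ i :=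
  mul_nonneg (sub_nonneg.2 (hd.α_le_one i)) (hy.2.2.1 i)

theorem DualFeasible.sum_surplus_le (i : Fin n) :
    ∑ j, (α i * v i j (x i j) - p j * x i j) ≤
      ∑ j, sSup ((fun t : ℝ => α i * v i j t - p j * t) '' Set.Ici 0) :=
  Finset.sum_le_sum fun j _ => hd.surplus_le_sSup i j (hy.1 i j)

include hB

theorem DualFeasible.log_term_le (i : Fin n) :
    B i * Real.log (u i) - α i * u i ≤ B i * Real.log (B i / α i) - B i :=
  mul_log_sub_mul_le (hB i) (hd.α_pos i) (hy.2.1 i) (hy.2.2.2 i)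

theorem DualFeasible.lagrangian_le_dualObj : lagrangian B v α p x u δ ≤ dualObj B v α p := by
  have hlog := Fintype.sum_mono (hd.log_term_le hB hy)
  have hsaving := Finset.sum_nonneg fun i (_ : _ ∈ Finset.univ) => hd.saving_term_nonneg hy i
  have hsurplus := Fintype.sum_mono (hd.sum_surplus_le hy)
  rw [lagrangian_eq_separable, dualObj]
  linarith

theorem DualFeasible.complementary_slackness
    (hle : dualObj B v α p ≤ lagrangian B v α p x u δ) :
    (∀ i, α i * u i = B i) ∧ (∀ i, (1 - α i) * δ i = 0) ∧
      ∀ i j, IsMaxOn (fun t => α i * v i j t - p j * t) (Set.Ici 0) (x i j) := by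
  have hlog := Fintype.sum_mono (hd.log_term_le hB hy)
  have hsaving := Finset.sum_nonneg fun i (_ : _ ∈ Finset.univ) => hd.saving_term_nonneg hy i
  have hsurplus := Fintype.sum_mono (hd.sum_surplus_le hy)
  rw [lagrangian_eq_separable, dualObj] at hle
  refine ⟨fun i => ?_,
    congrFun ((Fintype.sum_eq_zero_iff_of_nonneg (hd.saving_term_nonneg hy)).1 (by linarith)),
    fun i j t ht => ?_⟩
  · have hlog_eq := (Finset.sum_eq_sum_iff_of_le fun i _ => hd.log_term_le hB hy i).1
      (by linarith) i (Finset.mem_univ i)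
    by_contra hne
    exact (mul_log_sub_mul_lt (hB i) (hd.α_pos i) (hy.2.1 i) (hy.2.2.2 i) hne).ne hlog_eq
  · have hsurplus_eq := (Finset.sum_eq_sum_iff_of_le fun i _ => hd.sum_surplus_le hy i).1
      (by linarith) i (Finset.mem_univ i)
    exact (hd.surplus_le_sSup i j ht).trans_eq ((Finset.sum_eq_sum_iff_of_le fun j _ =>
      hd.surplus_le_sSup i j (hy.1 i j)).1 hsurplus_eq j (Finset.mem_univ j)).symm

end DualSlack

theorem IsPrimalSolution.dualObj_le_primalObj (hB : ∀ i, 0 ≤ B i)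
    (hv : ∀ i j, IsValuation (v i j)) (hprimal : IsPrimalSolution B v x u δ)
    (hdual : IsDualSolution B v α p) : dualObj B v α p ≤ primalObj B u δ := by
  obtain ⟨α', p', hα', hp', hmult⟩ := hprimal.exists_multipliers hB hv
  have hd := hdual.feasible
  have hα_mid : ∀ i, 0 < (α i + α' i) / 2 := fun i =>
    half_pos (add_pos_of_pos_of_nonneg (hd.α_pos i) (hα' i))
  have hp_mid : ∀ j, 0 ≤ (p j + p' j) / 2 := fun j =>
    div_nonneg (add_nonneg (hd.p_nonneg j) (hp' j)) zero_le_two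
  have hmid : ∀ y ∈ primalDomain m B,
      lagrangian B v (fun i => (α i + α' i) / 2) (fun j => (p j + p' j) / 2) y.1 y.2.1 y.2.2 ≤
        (dualObj B v α p + primalObj B u δ) / 2 := fun y hy => by
    rw [lagrangian_midpoint]
    linarith [hd.lagrangian_le_dualObj hB hy, hmult y hy]
  linarith [hdual.optimal _ _ (dualFeasible_of_lagrangian_le hB hα_mid hmid hp_mid),
    dualObj_le_of_lagrangian_le hB hα_mid hmid]


/-! ### Market equilibrium -/

/-- A market equilibrium in which buyer `i` scales all values by `α i` and keeps the value `δ i`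
unspent: prices clear the market and every buyer demands the allocated goods. These are the
Karush–Kuhn–Tucker conditions of the primal program, with `u i` eliminated. -/
structure IsEquilibrium (B : Fin n → ℝ) (v : Fin n → Fin m → ℝ → ℝ)
    (x : Fin n → Fin m → ℝ) (δ α : Fin n → ℝ) (p : Fin m → ℝ) : Prop where
  α_pos : ∀ i, 0 < α i
  α_le_one : ∀ i, α i ≤ 1
  p_nonneg : ∀ j, 0 ≤ p j
  x_nonneg : ∀ i j, 0 ≤ x i j
  δ_nonneg : ∀ i, 0 ≤ δ i
  supply : ∀ j, ∑ i, x i j ≤ 1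
  clearing : ∀ j, p j * ∑ i, x i j = p j
  budget : ∀ i, α i * (∑ j, v i j (x i j) + δ i) = B i
  saving : ∀ i, α i = 1 ∨ δ i = 0
  demand : ∀ i j, IsMaxOn (fun t => α i * v i j t - p j * t) (Set.Ici 0) (x i j)

theorem IsPrimalSolution.isEquilibrium (hB : ∀ i, 0 ≤ B i) (hv : ∀ i j, IsValuation (v i j))
    (hprimal : IsPrimalSolution B v x u δ) (hdual : IsDualSolution B v α p) :
    IsEquilibrium B v x δ α p := by
  have hf := hprimal.feasible
  have hd := hdual.feasible
  have hα : ∀ i, 0 ≤ α i := fun i => (hd.α_pos i).le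
  have hgap := hprimal.dualObj_le_primalObj hB hv hdual
  have hprimal_le := hf.primalObj_le_lagrangian hα hd.p_nonneg
  have hle_dual := hd.lagrangian_le_dualObj hB hf.mem_primalDomain
  obtain ⟨hutility, hsupply⟩ :=
    hf.complementary_slackness hα hd.p_nonneg (hle_dual.trans hgap)
  obtain ⟨hbudget, hsaving, hdemand⟩ :=
    hd.complementary_slackness hB hf.mem_primalDomain (hgap.trans hprimal_le)
  exact
    { α_pos := hd.α_pos
      α_le_one := hd.α_le_one
      p_nonneg := hd.p_nonneg
      x_nonneg := hf.x_nonneg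
      δ_nonneg := hf.δ_nonneg
      supply := hf.supply
      clearing := fun j => by linarith [hsupply j]
      budget := fun i => by linarith [hutility i, hbudget i]
      saving := fun i => (mul_eq_zero.1 (hsaving i)).imp_left fun h => (sub_eq_zero.1 h).symm
      demand := hdemand }

namespace IsEquilibrium

variable (h : IsEquilibrium B v x δ α p)

include h

theorem payment_nonneg (i : Fin n) (j : Fin m) : 0 ≤ p j * x i j :=
  mul_nonneg (h.p_nonneg j) (h.x_nonneg i j)

theorem revenue_nonneg : 0 ≤ ∑ i, ∑ j, p j * x i j :=
  Finset.sum_nonneg fun i _ => Finset.sum_nonneg fun j _ => h.payment_nonneg i j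

theorem allocation_le_one (i : Fin n) (j : Fin m) : x i j ≤ 1 :=
  (Finset.single_le_sum (fun k _ => h.x_nonneg k j) (Finset.mem_univ i)).trans (h.supply j)

theorem sum_price_mul_le_revenue {y : Fin n → Fin m → ℝ} (hy : ∀ j, ∑ i, y i j ≤ 1) :
    ∑ i, ∑ j, p j * y i j ≤ ∑ i, ∑ j, p j * x i j := by
  rw [Finset.sum_comm, Finset.sum_comm (f := fun i j => p j * x i j)]
  simp only [← Finset.mul_sum, h.clearing]
  exact Finset.sum_le_sum fun j _ => mul_le_of_le_one_right (h.p_nonneg j) (hy j)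

theorem payment_le_scaled_value (hv : ∀ i j, IsValuation (v i j)) (i : Fin n) (j : Fin m) :
    p j * x i j ≤ α i * v i j (x i j) := by
  have : α i * v i j 0 - p j * 0 ≤ α i * v i j (x i j) - p j * x i j :=
    h.demand i j Set.self_mem_Ici
  rw [(hv i j).zero] at this
  linarith

theorem payment_le_value (hv : ∀ i j, IsValuation (v i j)) (i : Fin n) (j : Fin m) :
    p j * x i j ≤ v i j (x i j) :=
  (h.payment_le_scaled_value hv i j).trans
    (mul_le_of_le_one_left ((hv i j).nonneg (h.x_nonneg i j)) (h.α_le_one i))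

theorem sum_payment_le_budget (hv : ∀ i j, IsValuation (v i j)) (i : Fin n) :
    ∑ j, p j * x i j ≤ B i := by
  calc ∑ j, p j * x i j
      ≤ ∑ j, α i * v i j (x i j) := Finset.sum_le_sum fun j _ => h.payment_le_scaled_value hv i j
    _ = α i * ∑ j, v i j (x i j) := (Finset.mul_sum _ _ _).symm
    _ ≤ α i * (∑ j, v i j (x i j) + δ i) :=
        mul_le_mul_of_nonneg_left (le_add_of_nonneg_right (h.δ_nonneg i)) (h.α_pos i).le
    _ = B i := h.budget i

section RevenueBound

variable {ρ : ℝ} (hρ : ∀ i j, α i * v i j (x i j) ≤ ρ * (p j * x i j))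

include hρ

/-- A buyer with `α i = 1` compares `y i j` with the demanded quantity `x i j` good by good, and a
buyer with `α i < 1` has no savings, so that the budget is the scaled value of the allocation. -/
theorem sum_feasible_payment_le {y b : Fin n → Fin m → ℝ} (hb : RMVUPFeasible B v y b)
    (i : Fin n) : ∑ j, b i j ≤ ρ * ∑ j, p j * x i j + ∑ j, p j * y i j := by
  rcases h.saving i with hα | hδ
  · rw [Finset.mul_sum, ← Finset.sum_add_distrib]
    refine Finset.sum_le_sum fun j _ => ?_
    have hdemand : α i * v i j (y i j) - p j * y i j ≤ α i * v i j (x i j) - p j * x i j :=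
      h.demand i j (hb.x_nonneg i j)
    have hvalue := hρ i j
    rw [hα, one_mul] at hdemand hvalue
    linarith [hb.rational i j, h.payment_nonneg i j]
  · calc ∑ j, b i j
        ≤ B i := hb.budget i
      _ = ∑ j, α i * v i j (x i j) := by rw [← h.budget i, hδ, add_zero, Finset.mul_sum]
      _ ≤ ρ * ∑ j, p j * x i j := by
          rw [Finset.mul_sum]
          exact Finset.sum_le_sum fun j _ => hρ i j
      _ ≤ ρ * ∑ j, p j * x i j + ∑ j, p j * y i j :=
          le_add_of_nonneg_right (Finset.sum_nonneg fun j _ =>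
            mul_nonneg (h.p_nonneg j) (hb.x_nonneg i j))

theorem RMVUP_le (hρ0 : 0 ≤ ρ) : RMVUP B v ≤ (ρ + 1) * ∑ i, ∑ j, p j * x i j := by
  refine Real.sSup_le ?_ (mul_nonneg (by linarith) h.revenue_nonneg)
  rintro _ ⟨y, b, hb, rfl⟩
  calc ∑ i, ∑ j, b i j
      ≤ ∑ i, (ρ * ∑ j, p j * x i j + ∑ j, p j * y i j) :=
        Finset.sum_le_sum fun i _ => h.sum_feasible_payment_le hρ hb i
    _ = ρ * ∑ i, ∑ j, p j * x i j + ∑ i, ∑ j, p j * y i j := by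
        rw [Finset.sum_add_distrib, ← Finset.mul_sum]
    _ ≤ ρ * ∑ i, ∑ j, p j * x i j + ∑ i, ∑ j, p j * x i j :=
        add_le_add_right (h.sum_price_mul_le_revenue hb.supply) _
    _ = (ρ + 1) * ∑ i, ∑ j, p j * x i j := by ring

end RevenueBound

end IsEquilibrium

/-! ### Slopes of valuations -/

section Slopes

variable {f : ℝ → ℝ}

theorem IsValuation.le_derivWithin_mul (hf : IsValuation f)
    (hd : DifferentiableWithinAt ℝ f (Set.Ici 0) 0) {t : ℝ} (ht : 0 ≤ t) :
    f t ≤ derivWithin f (Set.Ici 0) 0 * t := by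
  rcases ht.eq_or_lt with rfl | ht
  · simp [hf.zero]
  · have := hf.concave.slope_le_derivWithin Set.self_mem_Ici ht.le ht hd
    rwa [slope_def_field, hf.zero, sub_zero, sub_zero, div_le_iff₀ ht] at this

theorem IsValuation.deriv_mul_le (hf : IsValuation f) {t : ℝ} (ht : 0 < t)
    (hd : DifferentiableAt ℝ f t) : deriv f t * t ≤ f t := by
  have := hf.concave.deriv_le_slope Set.self_mem_Ici ht.le ht hd
  rwa [slope_def_field, hf.zero, sub_zero, sub_zero, le_div_iff₀ ht] at this

theorem deriv_le_deriv_of_concaveOn {S : Set ℝ} (hf : ConcaveOn ℝ S f) {s t : ℝ} (hs : s ∈ S)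
    (ht : t ∈ S) (hst : s ≤ t) (hds : DifferentiableAt ℝ f s) (hdt : DifferentiableAt ℝ f t) :
    deriv f t ≤ deriv f s := by
  rcases hst.eq_or_lt with rfl | hst
  · exact le_rfl
  · exact (hf.deriv_le_slope hs ht hst hdt).trans (hf.slope_le_deriv hs ht hst hds)

theorem mul_deriv_le_of_isMaxOn (hf : ConcaveOn ℝ (Set.Ici 0) f) {a q s t : ℝ} (ha : 0 ≤ a)
    (hs : 0 ≤ s) (hst : s ≤ t) (ht : 0 < t)
    (hmax : IsMaxOn (fun t => a * f t - q * t) (Set.Ici 0) s) (hd : DifferentiableAt ℝ f t) :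
    a * deriv f t ≤ q := by
  rcases hst.eq_or_lt with rfl | hst
  · have hderiv : HasDerivAt (fun t => a * f t - q * t) (a * deriv f s - q * 1) s :=
      (hd.hasDerivAt.const_mul a).sub ((hasDerivAt_id s).const_mul q)
    linarith [(hmax.isLocalMax (Ici_mem_nhds ht)).hasDerivAt_eq_zero hderiv]
  · have hslope := hf.deriv_le_slope hs ht.le hst hd
    rw [slope_def_field, le_div_iff₀ (sub_pos.2 hst)] at hslope
    have hle : a * f t - q * t ≤ a * f s - q * s := hmax ht.le
    refine le_of_mul_le_mul_right ?_ (sub_pos.2 hst)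
    linarith [mul_le_mul_of_nonneg_left hslope ha]

/-- On `[t / r, t]` the derivative of `f` is at most `t * f' t / s`, which integrates to
`t * f' t * log r`, and concavity bounds `f (t / r)` by `f' 0 * (t / r) ≤ t * f' t`. -/
theorem IsValuation.le_one_add_log_mul (hf : IsValuation f)
    (hd0 : DifferentiableWithinAt ℝ f (Set.Ici 0) 0) {t r : ℝ} (ht : 0 < t)
    (hd : ∀ s ∈ Set.Ioc 0 t, DifferentiableAt ℝ f s)
    (hm : MonotoneOn (fun s => s * deriv f s) (Set.Ioc 0 t)) (hr : 1 ≤ r)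
    (hslope : derivWithin f (Set.Ici 0) 0 ≤ r * deriv f t) :
    f t ≤ (1 + Real.log r) * (t * deriv f t) := by
  have hr0 : 0 < r := zero_lt_one.trans_le hr
  have htr0 : 0 < t / r := div_pos ht hr0
  have htr : t / r ≤ t := div_le_self ht.le hr
  set c := t * deriv f t with hc
  have hderiv : ∀ s ∈ Set.Icc (t / r) t,
      HasDerivAt (fun s => f s - c * Real.log s) (deriv f s - c * s⁻¹) s := fun s hs =>
    (hd s ⟨htr0.trans_le hs.1, hs.2⟩).hasDerivAt.sub
      ((Real.hasDerivAt_log (htr0.trans_le hs.1).ne').const_mul c)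
  have hanti : AntitoneOn (fun s => f s - c * Real.log s) (Set.Icc (t / r) t) := by
    refine antitoneOn_of_hasDerivWithinAt_nonpos (convex_Icc _ _)
      (fun s hs => (hderiv s hs).continuousAt.continuousWithinAt)
      (fun s hs => (hderiv s (interior_subset hs)).hasDerivWithinAt) fun s hs => ?_
    have hs := interior_subset hs
    have hs0 := htr0.trans_le hs.1
    rw [sub_nonpos, ← div_eq_mul_inv, le_div_iff₀ hs0, mul_comm]
    exact hm ⟨hs0, hs.2⟩ ⟨ht, le_rfl⟩ hs.2
  have hstart : f (t / r) ≤ c := by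
    calc f (t / r) ≤ derivWithin f (Set.Ici 0) 0 * (t / r) := hf.le_derivWithin_mul hd0 htr0.le
      _ ≤ r * deriv f t * (t / r) := mul_le_mul_of_nonneg_right hslope htr0.le
      _ = c := by rw [hc]; field_simp
  have hend : f t - c * Real.log t ≤ f (t / r) - c * Real.log (t / r) :=
    hanti ⟨le_rfl, htr⟩ ⟨htr, le_rfl⟩ htr
  rw [Real.log_div ht.ne' hr0.ne'] at hend
  linarith

theorem derivWithin_Ici_eq_zero (hf : ∀ t, 0 ≤ t → f t = 0) :
    derivWithin f (Set.Ici 0) 0 = 0 := by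
  have hzero : Set.EqOn f (fun _ => 0) (Set.Ici 0) := fun t ht => hf t ht
  simp [derivWithin_congr hzero (hf 0 le_rfl)]

theorem RegularSlopes.derivWithin_le_of_div_le (hf : RegularSlopes f) {r : ℝ}
    (hr : derivWithin f (Set.Ici 0) 0 / deriv f 1 ≤ r) :
    derivWithin f (Set.Ici 0) 0 ≤ r * deriv f 1 := by
  rcases hf.pos_or_zero with hpos | hzero
  · exact (div_le_iff₀ hpos).1 hr
  · have hderiv : deriv f 1 = 0 := by
      have : f =ᶠ[nhds 1] fun _ => 0 := by
        filter_upwards [Ici_mem_nhds (zero_lt_one' ℝ)] with t ht using hzero t ht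
      rw [this.deriv_eq, deriv_const]
    rw [derivWithin_Ici_eq_zero hzero, hderiv, mul_zero]

theorem RegularSlopes.ratio_eq_zero_or_one_le (hs : RegularSlopes f) (hf : IsValuation f) :
    derivWithin f (Set.Ici 0) 0 / deriv f 1 = 0 ∨
      1 ≤ derivWithin f (Set.Ici 0) 0 / deriv f 1 := by
  rcases hs.pos_or_zero with hpos | hzero
  · right
    rw [one_le_div hpos]
    linarith [hf.deriv_mul_le one_pos hs.diff_one, hf.le_derivWithin_mul hs.diff_zero zero_le_one]
  · left
    rw [derivWithin_Ici_eq_zero hzero, zero_div]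

end Slopes

/-! ### The slope ratio -/

section SlopeRatio

theorem ratio_le_slopeRatio (v : Fin n → Fin m → ℝ → ℝ) (i : Fin n) (j : Fin m) :
    derivWithin (v i j) (Set.Ici 0) 0 / deriv (v i j) 1 ≤ slopeRatio v :=
  le_ciSup (f := fun ij : Fin n × Fin m =>
    derivWithin (v ij.1 ij.2) (Set.Ici 0) 0 / deriv (v ij.1 ij.2) 1)
    (Set.finite_range _).bddAbove (i, j)

variable (hv : ∀ i j, IsValuation (v i j)) (hs : ∀ i j, RegularSlopes (v i j))

include hs in
theorem derivWithin_le_slopeRatio_mul (i : Fin n) (j : Fin m) :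
    derivWithin (v i j) (Set.Ici 0) 0 ≤ slopeRatio v * deriv (v i j) 1 :=
  (hs i j).derivWithin_le_of_div_le (ratio_le_slopeRatio v i j)

include hv hs

theorem slopeRatio_eq_zero_or_one_le : slopeRatio v = 0 ∨ 1 ≤ slopeRatio v := by
  by_cases hex : ∃ i j, 1 ≤ derivWithin (v i j) (Set.Ici 0) 0 / deriv (v i j) 1
  · obtain ⟨i, j, hij⟩ := hex
    exact .inr (hij.trans (ratio_le_slopeRatio v i j))
  · left
    have hzero : ∀ i j, derivWithin (v i j) (Set.Ici 0) 0 / deriv (v i j) 1 = 0 := fun i j =>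
      ((hs i j).ratio_eq_zero_or_one_le (hv i j)).resolve_right fun h => hex ⟨i, j, h⟩
    simp only [slopeRatio, hzero, Real.iSup_const_zero]

theorem slopeRatio_nonneg : 0 ≤ slopeRatio v := by
  rcases slopeRatio_eq_zero_or_one_le hv hs with h | h <;> linarith

variable (heq : IsEquilibrium B v x δ α p)

include heq

theorem IsEquilibrium.RMVUP_le_slopeRatio_add_one_mul :
    RMVUP B v ≤ (slopeRatio v + 1) * ∑ i, ∑ j, p j * x i j := by
  refine heq.RMVUP_le (fun i j => ?_) (slopeRatio_nonneg hv hs)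
  have hx := heq.x_nonneg i j
  have hα := (heq.α_pos i).le
  have hr := slopeRatio_nonneg hv hs
  calc α i * v i j (x i j)
      ≤ α i * (slopeRatio v * deriv (v i j) 1 * x i j) := by
        gcongr
        exact ((hv i j).le_derivWithin_mul (hs i j).diff_zero hx).trans
          (mul_le_mul_of_nonneg_right (derivWithin_le_slopeRatio_mul hs i j) hx)
    _ = slopeRatio v * (α i * deriv (v i j) 1 * x i j) := by ring
    _ ≤ slopeRatio v * (p j * x i j) := by
        gcongr
        exact mul_deriv_le_of_isMaxOn (hv i j).concave hα hx (heq.allocation_le_one i j) one_pos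
          (heq.demand i j) (hs i j).diff_one

section LogBound

variable (hd : ∀ i j, ∀ t ∈ Set.Ioo (0 : ℝ) 1, DifferentiableAt ℝ (v i j) t)
  (hm : ∀ i j, MonotoneOn (fun t : ℝ => t * deriv (v i j) t) (Set.Ioc 0 1))

include hd hm

theorem IsEquilibrium.scaled_value_le_one_add_log_mul_payment (hr : 1 ≤ slopeRatio v)
    (i : Fin n) (j : Fin m) :
    α i * v i j (x i j) ≤ (1 + Real.log (slopeRatio v)) * (p j * x i j) := by
  rcases (heq.x_nonneg i j).eq_or_lt with hx | hx
  · simp [← hx, (hv i j).zero]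
  have hx1 := heq.allocation_le_one i j
  have hα := (heq.α_pos i).le
  have hlog : 0 ≤ 1 + Real.log (slopeRatio v) := by linarith [Real.log_nonneg hr]
  have hdiff : ∀ t ∈ Set.Ioc 0 (x i j), DifferentiableAt ℝ (v i j) t := fun t ht => by
    rcases (ht.2.trans hx1).eq_or_lt with rfl | ht1
    exacts [(hs i j).diff_one, hd i j t ⟨ht.1, ht1⟩]
  have hdx := hdiff (x i j) ⟨hx, le_rfl⟩
  have hslope : derivWithin (v i j) (Set.Ici 0) 0 ≤ slopeRatio v * deriv (v i j) (x i j) :=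
    (derivWithin_le_slopeRatio_mul hs i j).trans <|
      mul_le_mul_of_nonneg_left
        (deriv_le_deriv_of_concaveOn (hv i j).concave hx.le (Set.mem_Ici.2 zero_le_one) hx1 hdx
          (hs i j).diff_one)
        (slopeRatio_nonneg hv hs)
  calc α i * v i j (x i j)
      ≤ α i * ((1 + Real.log (slopeRatio v)) * (x i j * deriv (v i j) (x i j))) := by
        gcongr
        exact (hv i j).le_one_add_log_mul (hs i j).diff_zero hx hdiff
          ((hm i j).mono (Set.Ioc_subset_Ioc_right hx1)) hr hslope
    _ = (1 + Real.log (slopeRatio v)) * (α i * deriv (v i j) (x i j) * x i j) := by ring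
    _ ≤ (1 + Real.log (slopeRatio v)) * (p j * x i j) := by
        gcongr
        exact mul_deriv_le_of_isMaxOn (hv i j).concave hα hx.le le_rfl hx (heq.demand i j) hdx

theorem IsEquilibrium.RMVUP_le_log_slopeRatio_add_two_mul :
    RMVUP B v ≤ (1 + Real.log (slopeRatio v) + 1) * ∑ i, ∑ j, p j * x i j := by
  rcases slopeRatio_eq_zero_or_one_le hv hs with hr | hr
  · have hle := heq.RMVUP_le_slopeRatio_add_one_mul hv hs
    rw [hr] at hle ⊢
    rw [Real.log_zero]
    linarith [heq.revenue_nonneg]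
  · exact heq.RMVUP_le (heq.scaled_value_le_one_add_log_mul_payment hv hs hd hm hr)
      (by linarith [Real.log_nonneg hr])

end LogBound

end SlopeRatio

/-! ### Revenue guarantees -/

theorem one_add_log_le_logb_two_mul {s : ℝ} (hs : 1 ≤ s) :
    1 + Real.log s ≤ Real.logb 2 (2 * s) := by
  have hlog_two : Real.log 2 ≤ 1 := Real.log_two_lt_d9.le.trans (by norm_num)
  rw [Real.logb_mul two_ne_zero (by positivity), Real.logb_self_eq_one one_lt_two]
  gcongr
  exact le_div_self (Real.log_nonneg hs) (Real.log_pos one_lt_two) hlog_two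

theorem log_le_two_mul_log_one_add_div_two {r : ℝ} (hr : 0 < r) :
    Real.log r ≤ 2 * Real.log ((1 + r) / 2) := by
  have hamgm : r ≤ ((1 + r) / 2) ^ 2 := by linarith [sq_nonneg ((1 - r) / 2)]
  simpa only [Real.log_pow, Nat.cast_ofNat] using Real.log_le_log hr hamgm

theorem log_add_two_le_logb_mul {r : ℝ} (hr : 1 ≤ r) :
    1 + Real.log r + 1 ≤ Real.logb 2 (1 + r) * (Real.logb 2 (1 + r) + 1) := by
  have hs : 1 ≤ (1 + r) / 2 := by linarith
  have hlogb := one_add_log_le_logb_two_mul hs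
  rw [mul_div_cancel₀ _ two_ne_zero] at hlogb
  have hlog := log_le_two_mul_log_one_add_div_two (zero_lt_one.trans_le hr)
  nlinarith [Real.log_nonneg hs]

namespace IsEquilibrium

variable (h : IsEquilibrium B v x δ α p)

include h

theorem one_div_mul_RMVUP_le {c ρ : ℝ} (hR : RMVUP B v ≤ c * ∑ i, ∑ j, p j * x i j)
    (hρ : 0 ≤ ρ) (hc : c ≤ ρ * (ρ + 1)) :
    1 / (ρ * (ρ + 1)) * RMVUP B v ≤ ∑ i, ∑ j, p j * x i j := by
  rw [one_div_mul_eq_div]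
  refine div_le_of_le_mul₀ (by positivity) h.revenue_nonneg (hR.trans ?_)
  rw [mul_comm _ (ρ * (ρ + 1))]
  exact mul_le_mul_of_nonneg_right hc h.revenue_nonneg

variable (hv : ∀ i j, IsValuation (v i j)) (hs : ∀ i j, RegularSlopes (v i j))

include hv hs

theorem one_div_slopeRatio_mul_RMVUP_le :
    1 / (slopeRatio v * (slopeRatio v + 1)) * RMVUP B v ≤ ∑ i, ∑ j, p j * x i j := by
  rcases slopeRatio_eq_zero_or_one_le hv hs with hr | hr
  · simpa [hr] using h.revenue_nonneg
  · exact h.one_div_mul_RMVUP_le (h.RMVUP_le_slopeRatio_add_one_mul hv hs) (by linarith)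
      (le_mul_of_one_le_left (by linarith) hr)

variable (hd : ∀ i j, ∀ t ∈ Set.Ioo (0 : ℝ) 1, DifferentiableAt ℝ (v i j) t)
  (hm : ∀ i j, MonotoneOn (fun t : ℝ => t * deriv (v i j) t) (Set.Ioc 0 1))

include hd hm

theorem one_div_log_mul_RMVUP_le :
    1 / ((1 + Real.log (slopeRatio v)) * (1 + Real.log (slopeRatio v) + 1)) * RMVUP B v ≤
      ∑ i, ∑ j, p j * x i j := by
  have hlog : 0 ≤ Real.log (slopeRatio v) := by
    rcases slopeRatio_eq_zero_or_one_le hv hs with hr | hr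
    · rw [hr, Real.log_zero]
    · exact Real.log_nonneg hr
  exact h.one_div_mul_RMVUP_le (h.RMVUP_le_log_slopeRatio_add_two_mul hv hs hd hm) (by linarith)
    (le_mul_of_one_le_left (by linarith) (by linarith))

theorem one_div_logb_mul_RMVUP_le :
    1 / (Real.logb 2 (1 + slopeRatio v) * (Real.logb 2 (1 + slopeRatio v) + 1)) * RMVUP B v ≤
      ∑ i, ∑ j, p j * x i j := by
  rcases slopeRatio_eq_zero_or_one_le hv hs with hr | hr
  · simpa [hr] using h.revenue_nonneg
  · exact h.one_div_mul_RMVUP_le (h.RMVUP_le_log_slopeRatio_add_two_mul hv hs hd hm)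
      (Real.logb_nonneg one_lt_two (by linarith)) (log_add_two_le_logb_mul hr)

end IsEquilibrium

end ConcaveMarket

theorem theorem6p1 {n m : ℕ} (B : Fin n → ℝ) (hB : ∀ i, 0 ≤ B i)
    (v : Fin n → Fin m → ℝ → ℝ) (hv : ∀ i j, ConcaveMarket.IsValuation (v i j))
    (x : Fin n → Fin m → ℝ) (u δ : Fin n → ℝ) (α : Fin n → ℝ) (p : Fin m → ℝ)
    (hprimal : ConcaveMarket.IsPrimalSolution B v x u δ)
    (hdual : ConcaveMarket.IsDualSolution B v α p) :
    -- individual rationality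
    (∀ i j, p j * x i j ≤ v i j (x i j)) ∧
    -- budget feasibility
    (∀ i, ∑ j, p j * x i j ≤ B i) ∧
    -- revenue guarantee for general concave valuations
    ((∀ i j, ConcaveMarket.RegularSlopes (v i j)) →
      ∀ ρ : ℝ, ρ = ConcaveMarket.slopeRatio v →
        1 / (ρ * (ρ + 1)) * ConcaveMarket.RMVUP B v ≤ ∑ i, ∑ j, p j * x i j) ∧
    -- revenue guarantee when `t * v'(t)` is nondecreasing
    ((∀ i j, ConcaveMarket.RegularSlopes (v i j)) →
      (∀ i j, ∀ t ∈ Set.Ioo (0 : ℝ) 1, DifferentiableAt ℝ (v i j) t) →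
      (∀ i j, MonotoneOn (fun t : ℝ => t * deriv (v i j) t) (Set.Ioc 0 1)) →
      ∀ ρ : ℝ, (ρ = 1 + Real.log (ConcaveMarket.slopeRatio v) ∨
          ρ = Real.logb 2 (1 + ConcaveMarket.slopeRatio v)) →
        1 / (ρ * (ρ + 1)) * ConcaveMarket.RMVUP B v ≤ ∑ i, ∑ j, p j * x i j) := by
  have heq := hprimal.isEquilibrium hB hv hdual
  refine ⟨heq.payment_le_value hv, heq.sum_payment_le_budget hv, ?_, ?_⟩
  · rintro hs _ rfl
    exact heq.one_div_slopeRatio_mul_RMVUP_le hv hs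
  · rintro hs hd hm _ (rfl | rfl)
    · exact heq.one_div_log_mul_RMVUP_le hv hs hd hm
    · exact heq.one_div_logb_mul_RMVUP_le hv hs hd hm
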